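/- Let $S=\mathbb{C}[x_1,\dots,x_r]$, and let $\prec$ be the (degree) reverse lexicographic order on its monomials with $x_1\succ x_2\succ\dots\succ x_r$: $x^A\prec x^B$ if $|A|<|B|$, or if $|A|=|B|$ and at the last index $s$ with $a_s\ne b_s$ one has $a_s>b_s$. For an ideal $I\subseteq S$ let $\mathrm{in}(I)$ be the ideal generated by the leading terms of the elements of $I$. The generic initial ideal $\mathrm{gin}(I)$ is the ideal that equals $\mathrm{in}(gI)$ for all $g$ in some non-empty Zariski open subset of $GL_r(\mathbb{C})$, where $g$ acts on $S$ by linear change of coordinates. For an exponent vector $J\neq 0$ put $\max(J)=\max\{i : j_i>0\}$. The generators of a monomial ideal are its minimal monomial generators. Let $n\ge 0$ and let $I\subseteq S$ be a homogeneous ideal generated in degree $\le n$. Then $\mathrm{gin}(I)$ exists. Let $x^{J_1},\dots,x^{J_N}$ be the generators of $\mathrm{gin}(I)$ in degree $\le n$. Then for every generator $P$ of $\mathrm{gin}(I)$ in degree $n+1$ there are $j$ with $|J_j|=n$ and an index $i$ with $1\le i<\max(J_j)$ such that $P\prec x_i x^{J_j}$. -/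

import Mathlib

open MvPolynomial

open scoped MonomialOrder

attribute [local instance] MvPolynomial.gradedAlgebra

noncomputable section

/-- The exponents of the monomials in `r` variables, a copy of `Fin r →₀ ℕ` that is ordered by the
(degree) reverse lexicographic order, for which `x_0 > x_1 > ⋯ > x_{r-1}`. -/
def RevLexExp (r : ℕ) : Type := Fin r →₀ ℕ

namespace RevLexExp

variable {r : ℕ}

instance : AddCommMonoid (RevLexExp r) := inferInstanceAs (AddCommMonoid (Fin r →₀ ℕ))

/-- The identity map, from the plain exponents to the ordered copy. -/
def equiv (r : ℕ) : (Fin r →₀ ℕ) ≃+ RevLexExp r := AddEquiv.refl (Fin r →₀ ℕ)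

/-- First compare the total degrees, then the exponents colexicographically, in the reversed
direction. -/
def key (a : RevLexExp r) : ℕ ×ₗ (Colex (Fin r →₀ ℕ))ᵒᵈ :=
  toLex (((equiv r).symm a).degree, OrderDual.toDual (toColex ((equiv r).symm a)))

theorem key_injective : Function.Injective (key (r := r)) := by
  intro a b h
  exact congrArg (fun z => (ofLex z).2) h

instance : LinearOrder (RevLexExp r) := LinearOrder.lift' (key (r := r)) key_injective

/-- `x^a` is smaller than `x^b` in the reverse lexicographic order iff its degree is smaller, or the
degrees agree and, at the last index where `a` and `b` differ, the entry of `a` is the larger. -/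
theorem lt_iff (a b : Fin r →₀ ℕ) :
    equiv r a < equiv r b ↔
      a.degree < b.degree ∨
        (a.degree = b.degree ∧ ∃ s : Fin r, (∀ k : Fin r, s < k → a k = b k) ∧ b s < a s) := by
  have h : equiv r a < equiv r b ↔ key (equiv r a) < key (equiv r b) := Iff.rfl
  rw [h, key, key, Prod.Lex.toLex_lt_toLex, OrderDual.toDual_lt_toDual, Finsupp.Colex.lt_iff]
  refine or_congr Iff.rfl (and_congr Iff.rfl (exists_congr fun s => and_congr ?_ Iff.rfl))
  exact forall_congr' fun k => imp_congr Iff.rfl eq_comm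

theorem degree_le_of_le {a b : Fin r →₀ ℕ} (h : equiv r a ≤ equiv r b) : a.degree ≤ b.degree := by
  rcases h.eq_or_lt with h | h
  · rw [(equiv r).injective h]
  · rcases (lt_iff a b).1 h with h | h
    · exact h.le
    · exact h.1.le

theorem add_lt_add_right_of_lt {a b : Fin r →₀ ℕ} (c : Fin r →₀ ℕ) (h : equiv r a < equiv r b) :
    equiv r (a + c) < equiv r (b + c) := by
  rw [lt_iff] at h ⊢
  simpa only [map_add, Finsupp.add_apply, add_lt_add_iff_right, add_left_inj] using h

instance : IsOrderedAddMonoid (RevLexExp r) where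
  add_le_add_left a b h c := by
    rcases h.eq_or_lt with rfl | h
    · exact le_rfl
    · exact (add_lt_add_right_of_lt ((equiv r).symm c) h).le

instance : WellFoundedLT (RevLexExp r) := by
  refine ⟨RelEmbedding.wellFounded_iff_isEmpty.2 ⟨fun f => ?_⟩⟩
  have hlt : ∀ i, f (i + 1) < f i := fun i => f.map_rel_iff.2 (Nat.lt_succ_self i)
  have hle : ∀ i, f i ≤ f 0 := by
    intro i
    induction i with
    | zero => exact le_rfl
    | succ i ih => exact (hlt i).le.trans ih
  have hinj : Function.Injective (fun i => (equiv r).symm (f i)) :=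
    (equiv r).symm.injective.comp f.injective
  refine Set.infinite_range_of_injective hinj
    ((Finsupp.finite_of_degree_le ((equiv r).symm (f 0)).degree).subset ?_)
  rintro _ ⟨i, rfl⟩
  exact degree_le_of_le (hle i)

end RevLexExp

/-- The (degree) reverse lexicographic order on the monomials in `x_0 > x_1 > ⋯ > x_{r-1}`. -/
def revLex (r : ℕ) : MonomialOrder (Fin r) where
  syn := RevLexExp r
  toSyn := RevLexExp.equiv r
  toSyn_monotone a b h := by
    rcases h.eq_or_lt with rfl | h
    · exact le_rfl
    · refine ((RevLexExp.lt_iff a b).2 (Or.inl ?_)).le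
      obtain ⟨c, rfl⟩ := exists_add_of_le h.le
      have hc : c ≠ 0 := by
        rintro rfl
        simp at h
      have := (Finsupp.degree_eq_zero_iff c).not.2 hc
      rw [map_add]
      omega

/-- The reverse lexicographic order, spelled out. -/
theorem revLex_lt_iff {r : ℕ} (a b : Fin r →₀ ℕ) :
    a ≺[revLex r] b ↔
      a.degree < b.degree ∨
        (a.degree = b.degree ∧ ∃ s : Fin r, (∀ k : Fin r, s < k → a k = b k) ∧ b s < a s) :=
  RevLexExp.lt_iff a b

/-- The initial ideal `in(I)`: it is generated by the leading terms of all elements of `I`. -/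
def initialIdeal {r : ℕ} (I : Ideal (MvPolynomial (Fin r) ℂ)) : Ideal (MvPolynomial (Fin r) ℂ) :=
  Ideal.span ((revLex r).leadingTerm '' (I : Set (MvPolynomial (Fin r) ℂ)))

/-- The linear change of coordinates `x_i ↦ ∑ j, g_{ij} x_j`. -/
def linearChange {r : ℕ} (g : Matrix.GeneralLinearGroup (Fin r) ℂ) :
    MvPolynomial (Fin r) ℂ →ₐ[ℂ] MvPolynomial (Fin r) ℂ :=
  aeval fun i => ∑ j, C (g.1 i j) * X j

/-- The ideal `g I`, where `g` acts by the linear change of coordinates. -/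
def transformIdeal {r : ℕ} (g : Matrix.GeneralLinearGroup (Fin r) ℂ)
    (I : Ideal (MvPolynomial (Fin r) ℂ)) : Ideal (MvPolynomial (Fin r) ℂ) :=
  I.map (linearChange g)

/-- A subset of `GL_r(ℂ)` is Zariski open if it is the set of the matrices at which some member of
a family of polynomials in the matrix entries does not vanish. -/
def IsZariskiOpenGL {r : ℕ} (U : Set (Matrix.GeneralLinearGroup (Fin r) ℂ)) : Prop :=
  ∃ F : Set (MvPolynomial (Fin r × Fin r) ℂ),
    U = {g | ∃ p ∈ F, eval (fun ij => g.1 ij.1 ij.2) p ≠ 0}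

/-- `M` is the generic initial ideal of `I`: there is a non-empty Zariski open set of coordinate
changes `g` for which the initial ideal of `g I` is `M`. -/
def IsGenericInitialIdeal {r : ℕ} (I M : Ideal (MvPolynomial (Fin r) ℂ)) : Prop :=
  ∃ U : Set (Matrix.GeneralLinearGroup (Fin r) ℂ),
    IsZariskiOpenGL U ∧ U.Nonempty ∧ ∀ g ∈ U, initialIdeal (transformIdeal g I) = M

/-- The generic initial ideal `gin(I)`. -/
def gin {r : ℕ} (I : Ideal (MvPolynomial (Fin r) ℂ)) : Ideal (MvPolynomial (Fin r) ℂ) :=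
  Classical.epsilon (IsGenericInitialIdeal I)

/-- `I` is generated in degree `≤ n`: it is generated by its homogeneous elements of degree at
most `n`. -/
def IsGeneratedInDegreeLE {r : ℕ} (I : Ideal (MvPolynomial (Fin r) ℂ)) (n : ℕ) : Prop :=
  I = Ideal.span {f | f ∈ I ∧ ∃ d ≤ n, f.IsHomogeneous d}

/-- `x^a` is one of the (minimal) generators of the monomial ideal `M`: it lies in `M`, and no
proper divisor of it does. -/
def IsMonomialGenerator {r : ℕ} (M : Ideal (MvPolynomial (Fin r) ℂ)) (a : Fin r →₀ ℕ) : Prop :=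
  monomial a (1 : ℂ) ∈ M ∧ ∀ b : Fin r →₀ ℕ, b < a → monomial b (1 : ℂ) ∉ M

/-- `max(J)`, the largest index `i` with `J i > 0` (and `⊥` for `J = 0`). -/
def maxIndex {r : ℕ} (J : Fin r →₀ ℕ) : WithBot (Fin r) :=
  J.support.max

end

/-!
The proof compares, for each degree `d` and exponent `a`, the numbers `leadCount (g I) d a` of
leading exponents `≽ a` of forms of degree `d` in `g I`, for all coordinate changes `g`. Such a
number is the rank of a matrix of coefficients, hence lower semicontinuous in `g`
(`exists_eval_ne_zero_leadCount_le`), so all the numbers of a given degree attain their maxima on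
a nonempty Zariski open set, and there they determine the leading exponents in that degree. The
generic leading exponents of all degrees form a monomial ideal. It is finitely generated, and
genericity in the degrees of its generators already gives `in(g I)` in all degrees, so `gin(I)`
exists (`exists_isGenericInitialIdeal`).

Maximality of the counts makes `gin(I)` stable (`single_add_mem_leadSet_of_maximal`): if `x_j x^B`
is a leading monomial but `x_i x^B` with `i < j` is not, then the shear `x_j ↦ x_j + t x_i` with a
general `t` increases the count at `a = x_i x^B`. Indeed, projected to the exponents `≽ a`, the
sheared form with leading monomial `x_j x^B` is `t` times a nonzero multiple of `x_i x^B` up to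
`O(t²)`, while the forms with leading exponents `≽ a` keep their leading terms up to `O(t)`.

The bound on the generators in degree `n + 1` is then Buchberger's criterion for a stable initial
ideal (`exists_lt_single_add`). Let `J = g I`, and choose forms `F A ∈ J_n` with leading exponents
`A`, so that `F A` is a multiple of the last variable in `x^A` whenever `x^A` is not a minimal
generator, which is possible by stability. Then `J_{n+1}` is spanned by the products `x_k F A`.
Those with `k ≥ max(A)` have distinct leading monomials, multiples of the `x^A`. If `i < max(A) =
m` and `F A = x_m f'`, then `x_i F A = x_m (x_i f')`, and reducing `x_i f' ∈ J_n` by the `F C`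
expresses `x_i F A` through a product with `m ≥ max(C)` and products with smaller leading
monomials. So only the products `x_i F A` with `x^A` a minimal generator and `i < max(A)` can
contribute a new leading monomial `P`, and if their leading monomials were all smaller than `P`,
they could not.
-/

/-! ### Leading exponents -/

section Lead

variable {σ R : Type*} [CommRing R]

/-- `a` is the leading exponent of `f`. Unlike `MonomialOrder.degree`, this excludes `f = 0`. -/
def HasLead (m : MonomialOrder σ) (f : MvPolynomial σ R) (a : σ →₀ ℕ) : Prop :=
  coeff a f ≠ 0 ∧ ∀ b, a ≺[m] b → coeff b f = 0

variable {m : MonomialOrder σ} {f : MvPolynomial σ R} {a : σ →₀ ℕ}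

theorem hasLead_degree (hf : f ≠ 0) : HasLead m f (m.degree f) :=
  ⟨MonomialOrder.coeff_degree_ne_zero_iff.2 hf, fun _ => MonomialOrder.coeff_eq_zero_of_lt⟩

theorem HasLead.ne_zero (h : HasLead m f a) : f ≠ 0 := by
  rintro rfl
  exact h.1 (coeff_zero _)

theorem HasLead.le_of_coeff_ne_zero (h : HasLead m f a) {b : σ →₀ ℕ} (hb : coeff b f ≠ 0) :
    b ≼[m] a :=
  not_lt.1 fun hlt => hb (h.2 b hlt)

theorem HasLead.degree_eq (h : HasLead m f a) : m.degree f = a :=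
  m.toSyn.injective (le_antisymm
    (h.le_of_coeff_ne_zero (MonomialOrder.coeff_degree_ne_zero_iff.2 h.ne_zero))
    (m.le_degree (mem_support_iff.2 h.1)))

theorem HasLead.mul [NoZeroDivisors R] (h : HasLead m f a) {g : MvPolynomial σ R} {b : σ →₀ ℕ}
    (hg : HasLead m g b) : HasLead m (f * g) (a + b) := by
  rw [← h.degree_eq, ← hg.degree_eq, ← m.degree_mul h.ne_zero hg.ne_zero]
  exact hasLead_degree (mul_ne_zero h.ne_zero hg.ne_zero)

theorem hasLead_monomial {c : R} (hc : c ≠ 0) : HasLead m (monomial a c) a := by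
  classical
  refine ⟨by simpa using hc, fun b hb => ?_⟩
  rw [coeff_monomial, if_neg]
  rintro rfl
  exact lt_irrefl _ hb

theorem HasLead.X_mul [NoZeroDivisors R] [Nontrivial R] (h : HasLead m f a) (i : σ) :
    HasLead m (X i * f) (Finsupp.single i 1 + a) :=
  (hasLead_monomial (one_ne_zero : (1 : R) ≠ 0)).mul h

/-- Polynomials with distinct leading exponents are linearly independent, and the leading exponent
of a nontrivial linear combination is one of theirs. -/
theorem exists_hasLead_sum [NoZeroDivisors R] {ι : Type*} [Fintype ι] {s : ι → MvPolynomial σ R}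
    {e : ι → σ →₀ ℕ} (he : Function.Injective e) (hs : ∀ i, HasLead m (s i) (e i)) {c : ι → R}
    (hc : c ≠ 0) : ∃ i, HasLead m (∑ j, c j • s j) (e i) := by
  classical
  obtain ⟨i₀, hi₀⟩ := Function.ne_iff.1 hc
  obtain ⟨i, hi, hmax⟩ := Finset.exists_max_image (Finset.univ.filter fun i => c i ≠ 0)
    (fun i => m.toSyn (e i)) ⟨i₀, by simpa using hi₀⟩
  simp only [Finset.mem_filter, Finset.mem_univ, true_and] at hi hmax
  have hzero : ∀ b, e i ≼[m] b → ∀ j, b ≠ e j → c j * coeff b (s j) = 0 := by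
    intro b hb j hbj
    by_cases hj : c j = 0
    · rw [hj, zero_mul]
    · rw [(hs j).2 b (lt_of_le_of_ne ((hmax j hj).trans hb)
        fun h => hbj (m.toSyn.injective h).symm), mul_zero]
  refine ⟨i, ?_, fun b hb => ?_⟩
  · rw [coeff_sum, Finset.sum_eq_single i]
    · rw [coeff_smul, smul_eq_mul]
      exact mul_ne_zero hi (hs i).1
    · intro j _ hj
      rw [coeff_smul, smul_eq_mul]
      exact hzero _ le_rfl j fun h => hj (he h).symm
    · simp
  · rw [coeff_sum]
    refine Finset.sum_eq_zero fun j _ => ?_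
    rw [coeff_smul, smul_eq_mul]
    by_cases hj : c j = 0
    · rw [hj, zero_mul]
    · rw [(hs j).2 b ((hmax j hj).trans_lt hb), mul_zero]

end Lead

/-! ### Initial ideals of homogeneous ideals -/

section LeadSet

variable {r : ℕ} {J : Ideal (MvPolynomial (Fin r) ℂ)}

/-- The exponents of degree `d` of the monomials in `in(J)`, for a homogeneous ideal `J`: the
leading exponents of the nonzero forms of degree `d` in `J`. -/
def leadSet (J : Ideal (MvPolynomial (Fin r) ℂ)) (d : ℕ) : Set (Fin r →₀ ℕ) :=
  {a | ∃ f ∈ J, f.IsHomogeneous d ∧ HasLead (revLex r) f a}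

theorem degree_of_mem_leadSet {d : ℕ} {a : Fin r →₀ ℕ} (h : a ∈ leadSet J d) : a.degree = d := by
  obtain ⟨f, -, hd, ha⟩ := h
  by_contra hne
  exact ha.1 (hd.coeff_eq_zero hne)

theorem mem_leadSet_of_hasLead (hJ : J.IsHomogeneous (homogeneousSubmodule (Fin r) ℂ))
    {f : MvPolynomial (Fin r) ℂ} (hf : f ∈ J) {a : Fin r →₀ ℕ} (ha : HasLead (revLex r) f a) :
    a ∈ leadSet J a.degree := by
  refine ⟨homogeneousComponent a.degree f, homogeneousComponent_mem_of_mem hJ hf _,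
    homogeneousComponent_isHomogeneous _ _, ?_, fun b hb => ?_⟩
  · rw [coeff_homogeneousComponent, if_pos rfl]
    exact ha.1
  · rw [coeff_homogeneousComponent, ha.2 b hb, ite_self]

theorem mem_leadSet_of_le {a b : Fin r →₀ ℕ} (h : a ∈ leadSet J a.degree) (hab : a ≤ b) :
    b ∈ leadSet J b.degree := by
  obtain ⟨c, rfl⟩ := exists_add_of_le hab
  obtain ⟨f, hf, hd, ha⟩ := h
  refine ⟨f * monomial c 1, J.mul_mem_right _ hf, ?_, ha.mul (hasLead_monomial one_ne_zero)⟩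
  rw [map_add]
  exact hd.mul (isHomogeneous_monomial _ rfl)

theorem initialIdeal_eq_span (hJ : J.IsHomogeneous (homogeneousSubmodule (Fin r) ℂ)) :
    initialIdeal J =
      Ideal.span ((fun a => monomial a (1 : ℂ)) '' {a | a ∈ leadSet J a.degree}) := by
  rw [initialIdeal, MonomialOrder.span_leadingTerm_eq_span_monomial']
  congr 1
  ext p
  constructor
  · rintro ⟨f, ⟨hf, hf0⟩, rfl⟩
    exact ⟨_, mem_leadSet_of_hasLead hJ hf (hasLead_degree hf0), rfl⟩
  · rintro ⟨a, ⟨f, hf, -, ha⟩, rfl⟩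
    exact ⟨f, ⟨hf, ha.ne_zero⟩, by simp only [ha.degree_eq]⟩

/-- A family of monomials that is closed under multiplication by monomials consists of all
monomials in the ideal that it generates. -/
theorem monomial_mem_span_iff {s : Set (Fin r →₀ ℕ)} (hs : ∀ a ∈ s, ∀ b, a ≤ b → b ∈ s)
    (a : Fin r →₀ ℕ) :
    monomial a (1 : ℂ) ∈ Ideal.span ((fun a => monomial a (1 : ℂ)) '' s) ↔ a ∈ s := by
  classical
  rw [mem_ideal_span_monomial_image]
  simp only [support_monomial, one_ne_zero, if_false, Finset.mem_singleton, forall_eq]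
  exact ⟨fun ⟨b, hb, hba⟩ => hs b hb a hba, fun h => ⟨a, h, le_rfl⟩⟩

theorem monomial_mem_initialIdeal (hJ : J.IsHomogeneous (homogeneousSubmodule (Fin r) ℂ))
    (a : Fin r →₀ ℕ) : monomial a (1 : ℂ) ∈ initialIdeal J ↔ a ∈ leadSet J a.degree := by
  rw [initialIdeal_eq_span hJ, monomial_mem_span_iff]
  · rfl
  · exact fun _ ha _ hab => mem_leadSet_of_le ha hab

end LeadSet

/-! ### Linear changes of coordinates -/

section LinearChange

variable {r : ℕ}

theorem linearChange_X (g : Matrix.GeneralLinearGroup (Fin r) ℂ) (i : Fin r) :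
    linearChange g (X i) = ∑ j, C (g.1 i j) * X j := by
  rw [linearChange, aeval_X]

theorem linearChange_linearChange (g h : Matrix.GeneralLinearGroup (Fin r) ℂ)
    (f : MvPolynomial (Fin r) ℂ) : linearChange g (linearChange h f) = linearChange (h * g) f := by
  have key : (linearChange g).comp (linearChange h) = linearChange (h * g) := by
    refine MvPolynomial.algHom_ext fun i => ?_
    simp only [AlgHom.comp_apply, linearChange_X, map_sum, map_mul, algHom_C, Units.val_mul,
      Matrix.mul_apply, Finset.mul_sum, Finset.sum_mul, ← C_eq_algebraMap]
    rw [Finset.sum_comm]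
    simp only [mul_assoc]
  exact DFunLike.congr_fun key f

theorem linearChange_one (f : MvPolynomial (Fin r) ℂ) : linearChange 1 f = f := by
  have key : linearChange (1 : Matrix.GeneralLinearGroup (Fin r) ℂ) = AlgHom.id ℂ _ := by
    refine MvPolynomial.algHom_ext fun i => ?_
    simp [linearChange_X, Matrix.one_apply, ite_mul]
  exact DFunLike.congr_fun key f

theorem linearChange_surjective (g : Matrix.GeneralLinearGroup (Fin r) ℂ) :
    Function.Surjective (linearChange g) := fun f =>
  ⟨linearChange g⁻¹ f, by rw [linearChange_linearChange, inv_mul_cancel, linearChange_one]⟩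

theorem isHomogeneous_linearChange (g : Matrix.GeneralLinearGroup (Fin r) ℂ)
    {f : MvPolynomial (Fin r) ℂ} {d : ℕ} (hf : f.IsHomogeneous d) :
    (linearChange g f).IsHomogeneous d := by
  have := hf.aeval (fun i => ∑ j, C (g.1 i j) * X j) (n := 1) fun i =>
    IsHomogeneous.sum _ _ _ fun j _ => isHomogeneous_C_mul_X _ _
  rwa [one_mul] at this

theorem mem_transformIdeal {g : Matrix.GeneralLinearGroup (Fin r) ℂ}
    {I : Ideal (MvPolynomial (Fin r) ℂ)} {f : MvPolynomial (Fin r) ℂ} :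
    f ∈ transformIdeal g I ↔ ∃ f' ∈ I, linearChange g f' = f := by
  rw [transformIdeal, Ideal.mem_map_iff_of_surjective _ (linearChange_surjective g)]

theorem transformIdeal_transformIdeal (g h : Matrix.GeneralLinearGroup (Fin r) ℂ)
    (I : Ideal (MvPolynomial (Fin r) ℂ)) :
    transformIdeal g (transformIdeal h I) = transformIdeal (h * g) I := by
  ext f
  simp only [mem_transformIdeal]
  constructor
  · rintro ⟨_, ⟨f', hf', rfl⟩, rfl⟩
    exact ⟨f', hf', (linearChange_linearChange g h f').symm⟩
  · rintro ⟨f', hf', rfl⟩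
    exact ⟨_, ⟨f', hf', rfl⟩, linearChange_linearChange g h f'⟩

theorem linearChange_homogeneousComponent (g : Matrix.GeneralLinearGroup (Fin r) ℂ) (d : ℕ)
    (f : MvPolynomial (Fin r) ℂ) :
    linearChange g (homogeneousComponent d f) = homogeneousComponent d (linearChange g f) := by
  classical
  conv_rhs => rw [← sum_homogeneousComponent f]
  rw [map_sum, map_sum]
  simp only [homogeneousComponent_of_mem
    ((mem_homogeneousSubmodule _ _).2 (isHomogeneous_linearChange g
      (homogeneousComponent_isHomogeneous _ f)))]
  rw [Finset.sum_ite_eq]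
  split_ifs with h
  · rfl
  · rw [homogeneousComponent_eq_zero _ _ (by simpa using h), map_zero]

theorem isHomogeneous_transformIdeal {I : Ideal (MvPolynomial (Fin r) ℂ)}
    (hI : I.IsHomogeneous (homogeneousSubmodule (Fin r) ℂ))
    (g : Matrix.GeneralLinearGroup (Fin r) ℂ) :
    (transformIdeal g I).IsHomogeneous (homogeneousSubmodule (Fin r) ℂ) := by
  intro d f hf
  obtain ⟨f', hf', rfl⟩ := mem_transformIdeal.1 hf
  have := decomposition.decompose'_apply (linearChange g f') d
  refine this.symm ▸ mem_transformIdeal.2 ⟨_, homogeneousComponent_mem_of_mem hI hf' d,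
    linearChange_homogeneousComponent g d f'⟩

theorem isGeneratedInDegreeLE_transformIdeal {I : Ideal (MvPolynomial (Fin r) ℂ)} {n : ℕ}
    (hI : IsGeneratedInDegreeLE I n) (g : Matrix.GeneralLinearGroup (Fin r) ℂ) :
    IsGeneratedInDegreeLE (transformIdeal g I) n := by
  refine le_antisymm ?_ (Ideal.span_le.2 fun f hf => hf.1)
  rw [transformIdeal, Ideal.map_le_iff_le_comap]
  conv_lhs => rw [hI]
  refine Ideal.span_le.2 fun f ⟨hf, d, hd, hfd⟩ => Ideal.subset_span ?_
  exact ⟨Ideal.mem_map_of_mem _ hf, d, hd, isHomogeneous_linearChange g hfd⟩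

end LinearChange

/-! ### Counting leading exponents -/

section LeadCount

variable {r : ℕ} {J : Ideal (MvPolynomial (Fin r) ℂ)}

theorem finite_leadSet (J : Ideal (MvPolynomial (Fin r) ℂ)) (d : ℕ) : (leadSet J d).Finite :=
  (Finsupp.finite_of_degree_le d).subset fun _ ha => (degree_of_mem_leadSet ha).le

/-- The number of exponents `b ≽ a` in `leadSet J d`. It is the dimension of the image of `J_d`
under the projection that keeps the coefficients at the exponents `b ≽ a`. -/
noncomputable def leadCount (J : Ideal (MvPolynomial (Fin r) ℂ)) (d : ℕ) (a : Fin r →₀ ℕ) : ℕ :=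
  {b | b ∈ leadSet J d ∧ a ≼[revLex r] b}.ncard

theorem finite_leadSet_ge (J : Ideal (MvPolynomial (Fin r) ℂ)) (d : ℕ) (a : Fin r →₀ ℕ) :
    {b | b ∈ leadSet J d ∧ a ≼[revLex r] b}.Finite :=
  (finite_leadSet J d).subset fun _ h => h.1

theorem card_le_leadCount {ι : Type*} [Fintype ι] {d : ℕ} {a : Fin r →₀ ℕ}
    {f : ι → MvPolynomial (Fin r) ℂ} (hf : ∀ i, f i ∈ J) (hd : ∀ i, (f i).IsHomogeneous d)
    (hne : ∀ c : ι → ℂ, c ≠ 0 → ∃ b, a ≼[revLex r] b ∧ coeff b (∑ i, c i • f i) ≠ 0) :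
    Fintype.card ι ≤ leadCount J d a := by
  have := (finite_leadSet_ge J d a).fintype
  -- A combination of the `f i` is determined by its coefficients at the counted exponents, because
  -- its own leading exponent is one of them.
  let φ : (ι → ℂ) →ₗ[ℂ] ({b | b ∈ leadSet J d ∧ a ≼[revLex r] b} → ℂ) :=
    LinearMap.pi fun b => (lcoeff ℂ b.1).comp (Fintype.linearCombination ℂ f)
  have hφ : Function.Injective φ := by
    rw [← LinearMap.ker_eq_bot, LinearMap.ker_eq_bot']
    intro c hc
    by_contra hc0
    obtain ⟨b, hab, hb⟩ := hne c hc0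
    have hlead : HasLead (revLex r) (∑ i, c i • f i) _ := hasLead_degree (by
      rintro h
      rw [h, coeff_zero] at hb
      exact hb rfl)
    refine hlead.1 (congrFun hc ⟨_, ⟨_, ?_, ?_, hlead⟩, hab.trans (hlead.le_of_coeff_ne_zero hb)⟩)
    · exact Submodule.sum_mem _ fun i _ => Submodule.smul_of_tower_mem _ _ (hf i)
    · exact IsHomogeneous.sum _ _ _ fun i _ => by
        rw [smul_eq_C_mul]
        exact (hd i).C_mul _
  have := LinearMap.finrank_le_finrank_of_injective hφ
  rwa [Module.finrank_fintype_fun_eq_card, Module.finrank_fintype_fun_eq_card,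
    ← Nat.card_eq_fintype_card (α := Set.Elem _), Nat.card_coe_set_eq] at this

theorem card_le_leadCount_of_det_ne_zero {ι : Type*} [Fintype ι] [DecidableEq ι] {d : ℕ}
    {a : Fin r →₀ ℕ} {f : ι → MvPolynomial (Fin r) ℂ} (hf : ∀ i, f i ∈ J)
    (hd : ∀ i, (f i).IsHomogeneous d) {e : ι → Fin r →₀ ℕ} (he : ∀ i, a ≼[revLex r] e i)
    (hdet : (Matrix.of fun i j => coeff (e j) (f i)).det ≠ 0) :
    Fintype.card ι ≤ leadCount J d a := by
  refine card_le_leadCount hf hd fun c hc => ?_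
  by_contra! hzero
  refine hc (Matrix.eq_zero_of_vecMul_eq_zero hdet (funext fun j => ?_))
  have := hzero (e j) (he j)
  simpa [coeff_sum, Matrix.vecMul, dotProduct] using this

theorem det_ne_zero_of_hasLead {ι : Type*} [Fintype ι] [DecidableEq ι]
    {f : ι → MvPolynomial (Fin r) ℂ} {e : ι → Fin r →₀ ℕ} (he : Function.Injective e)
    (hf : ∀ i, HasLead (revLex r) (f i) (e i)) :
    (Matrix.of fun i j => coeff (e j) (f i)).det ≠ 0 := by
  intro h
  obtain ⟨c, hc, hc0⟩ := Matrix.exists_vecMul_eq_zero_iff.2 h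
  obtain ⟨i, hi⟩ := exists_hasLead_sum he hf hc
  have := congrFun hc0 i
  exact hi.1 (by simpa [coeff_sum, Matrix.vecMul, dotProduct] using this)

/-- The counts `leadCount J d a` determine `leadSet J d`. -/
theorem leadSet_eq_of_leadCount_eq {J J' : Ideal (MvPolynomial (Fin r) ℂ)} {d : ℕ}
    (h : ∀ a, a.degree = d → leadCount J d a = leadCount J' d a) : leadSet J d = leadSet J' d := by
  -- At the largest exponent of the symmetric difference the two counts would differ by one.
  by_contra hne
  obtain ⟨a, ha, hmax⟩ := Set.exists_max_image (symmDiff (leadSet J d) (leadSet J' d))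
    (revLex r).toSyn (((finite_leadSet J d).union (finite_leadSet J' d)).subset
      symmDiff_le_sup) (Set.symmDiff_nonempty.2 hne)
  have habove : ∀ b, a ≺[revLex r] b → (b ∈ leadSet J d ↔ b ∈ leadSet J' d) := by
    intro b hb
    by_contra hb'
    exact absurd (hmax b (by rw [Set.mem_symmDiff]; tauto)) (not_le.2 hb)
  have key : ∀ {K K' : Ideal (MvPolynomial (Fin r) ℂ)}, a ∈ leadSet K d → a ∉ leadSet K' d →
      (∀ b, a ≺[revLex r] b → (b ∈ leadSet K d ↔ b ∈ leadSet K' d)) →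
      leadCount K' d a < leadCount K d a := by
    intro K K' haK haK' hKK'
    refine Set.ncard_lt_ncard ⟨fun b hb => ?_, fun hsub => haK' (hsub ⟨haK, le_rfl⟩).1⟩
      (finite_leadSet_ge K d a)
    refine ⟨?_, hb.2⟩
    rcases hb.2.eq_or_lt with hab | hab
    · rwa [← (revLex r).toSyn.injective hab]
    · exact (hKK' b hab).2 hb.1
  rcases (Set.mem_symmDiff).1 ha with ⟨h1, h2⟩ | ⟨h1, h2⟩
  · exact (key h1 h2 habove).ne' (h a (degree_of_mem_leadSet h1))
  · exact (key h1 h2 fun b hb => (habove b hb).symm).ne (h a (degree_of_mem_leadSet h1))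

theorem leadCount_mono {J J' : Ideal (MvPolynomial (Fin r) ℂ)} {d : ℕ}
    (h : leadSet J d ⊆ leadSet J' d) (a : Fin r →₀ ℕ) : leadCount J d a ≤ leadCount J' d a :=
  Set.ncard_le_ncard (fun _ hb => ⟨h hb.1, hb.2⟩) (finite_leadSet_ge J' d a)

end LeadCount

/-! ### Generic coordinates -/

section Generic

variable {r : ℕ}

/-- The point of affine space with the entries of `g` as its coordinates. -/
def entries (g : Matrix.GeneralLinearGroup (Fin r) ℂ) : Fin r × Fin r → ℂ :=
  fun ij => g.1 ij.1 ij.2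

/-- The linear change of coordinates by a matrix of indeterminates. -/
noncomputable def genericChange (r : ℕ) : MvPolynomial (Fin r) ℂ →ₐ[ℂ]
    MvPolynomial (Fin r) (MvPolynomial (Fin r × Fin r) ℂ) :=
  aeval fun i => ∑ j, C (X (i, j)) * X j

theorem coeff_linearChange (g : Matrix.GeneralLinearGroup (Fin r) ℂ) (f : MvPolynomial (Fin r) ℂ)
    (b : Fin r →₀ ℕ) :
    coeff b (linearChange g f) = eval (entries g) (coeff b (genericChange r f)) := by
  have key : (linearChange g : MvPolynomial (Fin r) ℂ →+* MvPolynomial (Fin r) ℂ) =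
      (map (eval (entries g))).comp (genericChange r : MvPolynomial (Fin r) ℂ →+* _) := by
    refine ringHom_ext (fun c => ?_) fun i => ?_
    · simp [genericChange, MvPolynomial.algebraMap_apply]
    · simp [genericChange, linearChange_X, entries]
  rw [← coeff_map]
  exact congrArg (coeff b) (DFunLike.congr_fun key f)

/-- Lower semicontinuity of the counts in the Zariski topology: the nonvanishing of a suitable minor
of the matrix of coefficients of `g I_d` bounds the count from below. -/
theorem exists_eval_ne_zero_leadCount_le (I : Ideal (MvPolynomial (Fin r) ℂ)) (d : ℕ)
    (a : Fin r →₀ ℕ) (g₀ : Matrix.GeneralLinearGroup (Fin r) ℂ) :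
    ∃ p : MvPolynomial (Fin r × Fin r) ℂ, eval (entries g₀) p ≠ 0 ∧ ∀ g, eval (entries g) p ≠ 0 →
      leadCount (transformIdeal g₀ I) d a ≤ leadCount (transformIdeal g I) d a := by
  classical
  set T := {b | b ∈ leadSet (transformIdeal g₀ I) d ∧ a ≼[revLex r] b} with hT
  have := (finite_leadSet_ge (transformIdeal g₀ I) d a).fintype
  have hex : ∀ b : T, ∃ f ∈ I, f.IsHomogeneous d ∧ HasLead (revLex r) (linearChange g₀ f) b.1 := by
    rintro ⟨b, ⟨f, hf, hd, hb⟩, -⟩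
    obtain ⟨f', hf', rfl⟩ := mem_transformIdeal.1 hf
    refine ⟨linearChange g₀⁻¹ (linearChange g₀ f'), ?_, isHomogeneous_linearChange _ hd, ?_⟩
    · rwa [linearChange_linearChange, mul_inv_cancel, linearChange_one]
    · rwa [linearChange_linearChange g₀, inv_mul_cancel, linearChange_one]
  choose f hf hd hlead using hex
  have heval : ∀ g, eval (entries g) (Matrix.of fun i j : T =>
      coeff j.1 (genericChange r (f i))).det =
      (Matrix.of fun i j : T => coeff j.1 (linearChange g (f i))).det := by
    intro g
    rw [RingHom.map_det]
    congr 1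
    ext i j
    exact (coeff_linearChange g (f i) j.1).symm
  refine ⟨(Matrix.of fun i j : T => coeff j.1 (genericChange r (f i))).det, ?_, fun g hg => ?_⟩
  · rw [heval]
    exact det_ne_zero_of_hasLead Subtype.val_injective hlead
  · rw [heval] at hg
    have := card_le_leadCount_of_det_ne_zero (J := transformIdeal g I) (a := a)
      (fun i => mem_transformIdeal.2 ⟨f i, hf i, rfl⟩)
      (fun i => isHomogeneous_linearChange g (hd i)) (fun i => i.2.2) hg
    rwa [← Nat.card_eq_fintype_card, Nat.card_coe_set_eq] at this

/-- A coordinate change is generic for `I` in degree `d` if all counts of leading exponents of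
`g I` in degree `d` attain the maximal values that they can have. -/
def IsGenericInDegree (I : Ideal (MvPolynomial (Fin r) ℂ)) (d : ℕ)
    (g : Matrix.GeneralLinearGroup (Fin r) ℂ) : Prop :=
  ∀ h a, a.degree = d → leadCount (transformIdeal h I) d a ≤ leadCount (transformIdeal g I) d a

theorem IsGenericInDegree.leadSet_eq {I : Ideal (MvPolynomial (Fin r) ℂ)} {d : ℕ}
    {g h : Matrix.GeneralLinearGroup (Fin r) ℂ} (hg : IsGenericInDegree I d g)
    (hh : IsGenericInDegree I d h) :
    leadSet (transformIdeal g I) d = leadSet (transformIdeal h I) d :=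
  leadSet_eq_of_leadCount_eq fun a ha => le_antisymm (hh g a ha) (hg h a ha)

theorem IsGenericInDegree.leadSet_eq_of_subset {I : Ideal (MvPolynomial (Fin r) ℂ)} {d : ℕ}
    {g h : Matrix.GeneralLinearGroup (Fin r) ℂ} (hg : IsGenericInDegree I d g)
    (hgh : leadSet (transformIdeal g I) d ⊆ leadSet (transformIdeal h I) d) :
    leadSet (transformIdeal g I) d = leadSet (transformIdeal h I) d :=
  leadSet_eq_of_leadCount_eq fun a ha => le_antisymm (leadCount_mono hgh a) (hg h a ha)

theorem exists_forall_eval_ne_zero_isGenericInDegree (I : Ideal (MvPolynomial (Fin r) ℂ)) (d : ℕ) :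
    ∃ p : MvPolynomial (Fin r × Fin r) ℂ, p ≠ 0 ∧
      ∀ g, eval (entries g) p ≠ 0 → IsGenericInDegree I d g := by
  have hfin : {a : Fin r →₀ ℕ | a.degree = d}.Finite :=
    (Finsupp.finite_of_degree_le d).subset fun a ha => le_of_eq ha
  have hmax : ∀ a : Fin r →₀ ℕ, ∃ g₀, ∀ h,
      leadCount (transformIdeal h I) d a ≤ leadCount (transformIdeal g₀ I) d a := by
    intro a
    have hbdd : BddAbove (Set.range fun g => leadCount (transformIdeal g I) d a) := by
      refine ⟨{a : Fin r →₀ ℕ | a.degree = d}.ncard, ?_⟩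
      rintro _ ⟨g, rfl⟩
      exact Set.ncard_le_ncard (fun b hb => degree_of_mem_leadSet hb.1) hfin
    obtain ⟨g₀, hg₀⟩ := Nat.sSup_mem (Set.range_nonempty _) hbdd
    exact ⟨g₀, fun h => (le_csSup hbdd ⟨h, rfl⟩).trans_eq hg₀.symm⟩
  choose g₀ hg₀ using hmax
  choose p hp hple using fun a => exists_eval_ne_zero_leadCount_le I d a (g₀ a)
  refine ⟨∏ a ∈ hfin.toFinset, p a, Finset.prod_ne_zero_iff.2 fun a _ h => hp a ?_, ?_⟩
  · rw [h, map_zero]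
  · intro g hg h a ha
    rw [map_prod, Finset.prod_ne_zero_iff] at hg
    exact (hg₀ a h).trans (hple a g (hg a (hfin.mem_toFinset.2 ha)))

theorem exists_eval_entries_ne_zero {p : MvPolynomial (Fin r × Fin r) ℂ} (hp : p ≠ 0) :
    ∃ g : Matrix.GeneralLinearGroup (Fin r) ℂ, eval (entries g) p ≠ 0 := by
  by_contra! h
  refine mul_ne_zero hp (Matrix.det_mvPolynomialX_ne_zero (Fin r) ℂ) (funext fun x => ?_)
  rw [map_mul, map_zero, mul_eq_zero, RingHom.map_det]
  by_cases hx : (Matrix.of fun i j => x (i, j)).det = 0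
  · right
    rw [← hx]
    congr 1
    ext i j
    simp
  · exact Or.inl (h (Matrix.GeneralLinearGroup.mkOfDetNeZero _ hx))

/-- Genericity in finitely many degrees holds on a nonempty open set. -/
theorem exists_forall_eval_ne_zero_of_finset (I : Ideal (MvPolynomial (Fin r) ℂ)) (D : Finset ℕ) :
    ∃ p : MvPolynomial (Fin r × Fin r) ℂ, p ≠ 0 ∧
      ∀ g, eval (entries g) p ≠ 0 → ∀ d ∈ D, IsGenericInDegree I d g := by
  choose p hp hgen using exists_forall_eval_ne_zero_isGenericInDegree I
  refine ⟨∏ d ∈ D, p d, Finset.prod_ne_zero_iff.2 fun d _ => hp d, fun g hg d hd => ?_⟩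
  rw [map_prod, Finset.prod_ne_zero_iff] at hg
  exact hgen d g (hg d hd)

/-- The generic initial ideal exists. -/
theorem exists_isGenericInitialIdeal {I : Ideal (MvPolynomial (Fin r) ℂ)}
    (hI : I.IsHomogeneous (homogeneousSubmodule (Fin r) ℂ)) :
    ∃ M, IsGenericInitialIdeal I M := by
  classical
  have hgeneric : ∀ D : Finset ℕ, ∃ g, ∀ d ∈ D, IsGenericInDegree I d g := by
    intro D
    obtain ⟨p, hp, hpg⟩ := exists_forall_eval_ne_zero_of_finset I D
    obtain ⟨g, hg⟩ := exists_eval_entries_ne_zero hp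
    exact ⟨g, hpg g hg⟩
  -- Degree by degree, the leading exponents in generic coordinates.
  let s : Set (Fin r →₀ ℕ) :=
    {a | ∃ g, IsGenericInDegree I a.degree g ∧ a ∈ leadSet (transformIdeal g I) a.degree}
  have hs : ∀ a ∈ s, ∀ b, a ≤ b → b ∈ s := by
    rintro a ⟨g, hg, ha⟩ b hab
    obtain ⟨h, hh⟩ := hgeneric {a.degree, b.degree}
    rw [hg.leadSet_eq (hh a.degree (by simp))] at ha
    exact ⟨h, hh b.degree (by simp), mem_leadSet_of_le ha hab⟩
  -- Finitely many of these exponents generate, so genericity in their degrees is enough.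
  obtain ⟨t', ht's, ht'⟩ := (Submodule.fg_span_iff_fg_span_finset_subset _).1
    (IsNoetherian.noetherian (Ideal.span ((fun a => monomial a (1 : ℂ)) '' s)))
  obtain ⟨t, hts, rfl⟩ := Finset.subset_set_image_iff.1 ht's
  obtain ⟨p, hp, hpg⟩ := exists_forall_eval_ne_zero_of_finset I (t.image Finsupp.degree)
  refine ⟨Ideal.span ((fun a => monomial a (1 : ℂ)) '' s), {g | eval (entries g) p ≠ 0},
    ⟨{p}, by simp only [Set.mem_singleton_iff, exists_eq_left]; rfl⟩,
    exists_eval_entries_ne_zero hp, fun g hg => ?_⟩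
  have hJ := isHomogeneous_transformIdeal hI g
  have hle : Ideal.span ((fun a => monomial a (1 : ℂ)) '' s) ≤
      initialIdeal (transformIdeal g I) := by
    rw [Ideal.span, ht', Submodule.span_le]
    rintro _ h
    obtain ⟨a, hat, rfl⟩ := Finset.mem_image.1 h
    obtain ⟨h, hh, ha⟩ := hts hat
    exact (monomial_mem_initialIdeal hJ a).2
      (hh.leadSet_eq (hpg g hg _ (Finset.mem_image_of_mem _ hat)) ▸ ha)
  have hsub : ∀ a ∈ s, a ∈ leadSet (transformIdeal g I) a.degree := fun a ha =>
    (monomial_mem_initialIdeal hJ a).1 (hle ((monomial_mem_span_iff hs a).2 ha))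
  rw [initialIdeal_eq_span hJ]
  congr 2
  refine Set.Subset.antisymm (fun a ha => ?_) hsub
  obtain ⟨h, hh⟩ := hgeneric {a.degree}
  have hha := hh a.degree (by simp)
  refine ⟨h, hha, ?_⟩
  rw [hha.leadSet_eq_of_subset (h := g)]
  · exact ha
  · intro b hb
    have hdeg := degree_of_mem_leadSet hb
    rw [← hdeg]
    exact hsub b ⟨h, by rwa [hdeg], by rwa [hdeg]⟩

end Generic

/-! ### Stability of generic initial ideals -/

section Stability

variable {r : ℕ}

/-- The change of coordinates `x_j ↦ x_j + t x_i` with an indeterminate `t`. -/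
noncomputable def genericShear (j i : Fin r) :
    MvPolynomial (Fin r) ℂ →ₐ[ℂ] MvPolynomial (Fin r) (Polynomial ℂ) :=
  aeval fun k => X k + if k = j then C Polynomial.X * X i else 0

/-- The first-order expansion of the shear. -/
theorem exists_genericShear_eq (j i : Fin r) (f : MvPolynomial (Fin r) ℂ) :
    ∃ q, genericShear j i f = map Polynomial.C f +
      C Polynomial.X * map Polynomial.C (X i * pderiv j f) + C (Polynomial.X ^ 2) * q := by
  induction f using MvPolynomial.induction_on with
  | C c =>
    refine ⟨0, ?_⟩
    simp [genericShear, MvPolynomial.algebraMap_apply]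
  | add f g hf hg =>
    obtain ⟨p, hp⟩ := hf
    obtain ⟨q, hq⟩ := hg
    refine ⟨p + q, ?_⟩
    rw [map_add, hp, hq]
    simp only [map_add, mul_add]
    ring
  | mul_X f k hf =>
    obtain ⟨q, hq⟩ := hf
    have hk : genericShear j i (X k) = X k + if k = j then C Polynomial.X * X i else 0 := by
      rw [genericShear, aeval_X]
    rw [map_mul, hq, hk, Derivation.leibniz]
    by_cases hkj : k = j
    · subst hkj
      refine ⟨q * X k + map Polynomial.C (X i * pderiv k f) * X i + C Polynomial.X * q * X i, ?_⟩
      simp only [if_true, pderiv_X_self, map_add, map_mul, map_X, map_pow, smul_eq_mul, mul_one]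
      ring
    · refine ⟨q * X k, ?_⟩
      rw [if_neg hkj, pderiv_X_of_ne hkj]
      simp only [map_add, map_mul, map_X, map_pow, smul_eq_mul, mul_zero, map_zero]
      ring

/-- The shears `x_j ↦ x_j + t x_i` with a complex number `t` are coordinate changes. -/
theorem exists_coeff_linearChange_eq {j i : Fin r} (hij : i ≠ j) (t : ℂ) :
    ∃ g : Matrix.GeneralLinearGroup (Fin r) ℂ, ∀ f b,
      coeff b (linearChange g f) = (coeff b (genericShear j i f)).eval t := by
  have hdet : (Matrix.transvection j i t).det ≠ 0 := by
    rw [Matrix.det_transvection_of_ne j i hij.symm]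
    exact one_ne_zero
  refine ⟨Matrix.GeneralLinearGroup.mkOfDetNeZero _ hdet, fun f b => ?_⟩
  set g := Matrix.GeneralLinearGroup.mkOfDetNeZero _ hdet
  have key : (linearChange g : MvPolynomial (Fin r) ℂ →+* MvPolynomial (Fin r) ℂ) =
      (map (Polynomial.evalRingHom t)).comp
        (genericShear j i : MvPolynomial (Fin r) ℂ →+* _) := by
    refine ringHom_ext (fun c => ?_) fun k => ?_
    · simp [genericShear, MvPolynomial.algebraMap_apply]
    · have hg : ∀ l, g.1 k l = (1 : Matrix (Fin r) (Fin r) ℂ) k l +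
          (Matrix.single j i t : Matrix (Fin r) (Fin r) ℂ) k l := fun l => rfl
      by_cases hkj : k = j
      · subst hkj
        simp [genericShear, linearChange_X, hg, Matrix.one_apply, Matrix.single_apply, add_mul,
          Finset.sum_add_distrib, ite_mul]
        rw [Finset.sum_eq_single i (fun l _ hl => by rw [if_neg hl.symm, map_zero, zero_mul])
          (by simp), if_pos rfl]
      · simp [genericShear, linearChange_X, hg, Matrix.one_apply, hkj, Ne.symm hkj, ite_mul]
  rw [← Polynomial.coe_evalRingHom, ← coeff_map]
  exact congrArg (coeff b) (DFunLike.congr_fun key f)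

theorem single_add_lt_single_add {i j : Fin r} (hij : i < j) (B : Fin r →₀ ℕ) :
    Finsupp.single j 1 + B ≺[revLex r] Finsupp.single i 1 + B := by
  refine (revLex_lt_iff _ _).2 (Or.inr ⟨by simp, j, fun k hk => ?_, ?_⟩)
  · simp [hk.ne, (hij.trans hk).ne]
  · simp [hij.ne]

/-- The derivation `x_i ∂/∂x_j` moves the leading exponent `x_j x^B` to `x_i x^B`. -/
theorem HasLead.X_mul_pderiv (i : Fin r) {j : Fin r} {f : MvPolynomial (Fin r) ℂ}
    {B : Fin r →₀ ℕ} (hf : HasLead (revLex r) f (Finsupp.single j 1 + B)) :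
    HasLead (revLex r) (X i * pderiv j f) (Finsupp.single i 1 + B) := by
  have hlead : HasLead (revLex r) (pderiv j f) B := by
    refine ⟨?_, fun b hb => ?_⟩
    · rw [coeff_pderiv, add_comm B]
      exact mul_ne_zero hf.1 (Nat.cast_add_one_ne_zero _)
    · rw [coeff_pderiv, add_comm b, hf.2, zero_mul]
      rw [map_add, map_add]
      exact add_lt_add_right hb _
  exact hlead.X_mul i

/-- If no coordinate change increases the counts in degree `d`, then the exponents of degree `d`
are stable: a factor `x_j` may be replaced by `x_i` with `i < j`. -/
theorem single_add_mem_leadSet_of_maximal {J : Ideal (MvPolynomial (Fin r) ℂ)} {d : ℕ}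
    (hmax : ∀ g a, a.degree = d → leadCount (transformIdeal g J) d a ≤ leadCount J d a)
    {i j : Fin r} (hij : i < j) {B : Fin r →₀ ℕ} (hB : Finsupp.single j 1 + B ∈ leadSet J d) :
    Finsupp.single i 1 + B ∈ leadSet J d := by
  classical
  by_contra hB'
  have hdeg : (Finsupp.single i 1 + B).degree = d := by
    rw [← degree_of_mem_leadSet hB]
    simp
  set a := Finsupp.single i 1 + B with ha
  set T := {b | b ∈ leadSet J d ∧ a ≼[revLex r] b} with hT
  have := (finite_leadSet_ge J d a).fintype
  have hex : ∀ b : T, ∃ f ∈ J, f.IsHomogeneous d ∧ HasLead (revLex r) f b.1 := fun b => b.2.1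
  choose f hf hd hlead using hex
  obtain ⟨f₀, hf₀, hd₀, hlead₀⟩ := hB
  -- For a general shear parameter `t`, the sheared forms `f b` with leading exponents `b ≽ a` and
  -- the sheared `f₀` have linearly independent projections to the exponents `≽ a`. This is one form
  -- more than the maximal count allows.
  let F : Option T → MvPolynomial (Fin r) ℂ := fun o => o.elim f₀ f
  let e : Option T → Fin r →₀ ℕ := fun o => o.elim a Subtype.val
  -- The lowest-order terms in `t` of these projections: order 0 for `f b`, order 1 for `f₀`.
  let F₁ : Option T → MvPolynomial (Fin r) ℂ := fun o => o.elim (X i * pderiv j f₀) f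
  have hae : ∀ o, a ≼[revLex r] e o := by
    rintro (_ | b)
    · exact le_rfl
    · exact b.2.2
  have he : Function.Injective e := by
    rintro (_ | b) (_ | b') h
    · rfl
    · exact absurd ((show a = b'.1 from h) ▸ b'.2.1) hB'
    · exact absurd ((show b.1 = a from h) ▸ b.2.1) hB'
    · exact congrArg some (Subtype.ext h)
  have hdet₁ := det_ne_zero_of_hasLead (f := F₁) he (by
    rintro (_ | b)
    · exact hlead₀.X_mul_pderiv i
    · exact hlead b)
  choose q hq using exists_genericShear_eq (r := r) j i
  have hzero₀ : ∀ o, coeff (e o) f₀ = 0 := fun o =>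
    hlead₀.2 _ ((single_add_lt_single_add hij B).trans_le (hae o))
  -- The matrix of coefficients of the sheared forms, with the row of `f₀` divided by `t`.
  let N : Matrix (Option T) (Option T) (Polynomial ℂ) := Matrix.of fun o o' =>
    o.elim (Polynomial.C (coeff (e o') (X i * pderiv j f₀)) +
      Polynomial.X * coeff (e o') (q f₀)) fun b => coeff (e o') (genericShear j i (f b))
  have hN₀ : N.det ≠ 0 := by
    intro h
    refine hdet₁ ?_
    have h0 := congrArg (Polynomial.evalRingHom 0) h
    rw [RingHom.map_det, map_zero] at h0
    rw [← h0]
    congr 1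
    ext o o'
    rcases o with _ | b
    · simp [N, F₁]
    · simp only [Matrix.of_apply, F₁, N, RingHom.mapMatrix_apply, Matrix.map_apply,
        Option.elim_some, hq, coeff_add, coeff_C_mul, coeff_map]
      simp
  obtain ⟨t, ht⟩ : ∃ t, (Polynomial.X * N.det).eval t ≠ 0 := by
    by_contra! h
    exact mul_ne_zero Polynomial.X_ne_zero hN₀ (Polynomial.funext fun t => by simpa using h t)
  rw [Polynomial.eval_mul, Polynomial.eval_X] at ht
  obtain ⟨g, hg⟩ := exists_coeff_linearChange_eq hij.ne t
  have hrow : (Matrix.of fun o o' => coeff (e o') (linearChange g (F o))) =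
      Matrix.diagonal (fun o : Option T => o.elim t fun _ => 1) *
        (Polynomial.evalRingHom t).mapMatrix N := by
    ext o o'
    rw [Matrix.diagonal_mul, Matrix.of_apply, hg]
    rcases o with _ | b
    · simp only [F, N, RingHom.mapMatrix_apply, Matrix.map_apply, Matrix.of_apply,
        Option.elim_none, hq, coeff_add, coeff_C_mul, coeff_map, hzero₀]
      simp
      ring
    · simp [F, N]
  have hcard := card_le_leadCount_of_det_ne_zero (J := transformIdeal g J) (d := d) (a := a)
    (f := fun o => linearChange g (F o)) (e := e) (by
      rintro (_ | b)
      · exact mem_transformIdeal.2 ⟨_, hf₀, rfl⟩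
      · exact mem_transformIdeal.2 ⟨_, hf b, rfl⟩) (by
      rintro (_ | b)
      · exact isHomogeneous_linearChange g hd₀
      · exact isHomogeneous_linearChange g (hd b)) hae (by
      rw [hrow, Matrix.det_mul, Matrix.det_diagonal, ← RingHom.map_det, Fintype.prod_option]
      simpa using ht)
  rw [Fintype.card_option, ← Nat.card_eq_fintype_card, Nat.card_coe_set_eq] at hcard
  exact absurd (hmax g a hdeg) (not_le.2 hcard)

theorem IsGenericInDegree.single_add_mem_leadSet {I : Ideal (MvPolynomial (Fin r) ℂ)} {d : ℕ}
    {g : Matrix.GeneralLinearGroup (Fin r) ℂ} (hg : IsGenericInDegree I d g) {i j : Fin r}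
    (hij : i < j) {B : Fin r →₀ ℕ}
    (hB : Finsupp.single j 1 + B ∈ leadSet (transformIdeal g I) d) :
    Finsupp.single i 1 + B ∈ leadSet (transformIdeal g I) d :=
  single_add_mem_leadSet_of_maximal (fun h a ha => by
    rw [transformIdeal_transformIdeal]
    exact hg (g * h) a ha) hij hB

end Stability

/-! ### Generators in degree `n + 1` -/

section Syzygies

variable {r : ℕ} {J : Ideal (MvPolynomial (Fin r) ℂ)} {n : ℕ}

theorem isMonomialGenerator_initialIdeal_iff
    (hJ : J.IsHomogeneous (homogeneousSubmodule (Fin r) ℂ)) (A : Fin r →₀ ℕ) :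
    IsMonomialGenerator (initialIdeal J) A ↔ A ∈ leadSet J A.degree ∧
      ∀ i B, A = Finsupp.single i 1 + B → B ∉ leadSet J B.degree := by
  simp only [IsMonomialGenerator, monomial_mem_initialIdeal hJ]
  refine and_congr Iff.rfl ⟨fun h i B hAB => h B ?_, fun h B hBA hB => ?_⟩
  · rw [hAB]
    exact lt_add_of_pos_left B (pos_iff_ne_zero.2 (by simp))
  · obtain ⟨E, rfl⟩ := exists_add_of_le hBA.le
    have hE : E ≠ 0 := by
      rintro rfl
      simp at hBA
    obtain ⟨i, hi⟩ := Finsupp.ne_iff.1 hE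
    obtain ⟨E', rfl⟩ : ∃ E', E = Finsupp.single i 1 + E' :=
      exists_add_of_le (Finsupp.single_le_iff.2 (Nat.one_le_iff_ne_zero.2 hi))
    exact h i (B + E') (add_left_comm _ _ _) (mem_leadSet_of_le hB le_self_add)

/-- An ideal generated in degree at most `n` satisfies `J_{n+1} = S_1 J_n`. -/
theorem mem_span_X_mul_of_isGeneratedInDegreeLE (hgen : IsGeneratedInDegreeLE J n)
    {f : MvPolynomial (Fin r) ℂ} (hf : f ∈ J) (hd : f.IsHomogeneous (n + 1)) :
    f ∈ Submodule.span ℂ {p | ∃ i, ∃ h ∈ J, h.IsHomogeneous n ∧ p = X i * h} := by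
  set S := Submodule.span ℂ {p | ∃ i, ∃ h ∈ J, h.IsHomogeneous n ∧ p = X i * h} with hS
  have key : ∀ f ∈ Ideal.span {f | f ∈ J ∧ ∃ d ≤ n, f.IsHomogeneous d}, ∀ q,
      homogeneousComponent (n + 1) (q * f) ∈ S := by
    intro f hf
    induction hf using Submodule.span_induction with
    | mem h hh =>
      obtain ⟨hhJ, d, hdn, hhd⟩ := hh
      intro q
      induction q using MvPolynomial.induction_on' with
      | monomial a c =>
        have hhom : (monomial a c * h).IsHomogeneous (a.degree + d) :=
          (isHomogeneous_monomial c rfl).mul hhd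
        rw [homogeneousComponent_of_mem ((mem_homogeneousSubmodule _ _).2 hhom)]
        split_ifs with hdeg
        · have ha : a ≠ 0 := by
            rintro rfl
            simp at hdeg
            omega
          obtain ⟨i, hi⟩ := Finsupp.ne_iff.1 ha
          obtain ⟨b, rfl⟩ : ∃ b, a = Finsupp.single i 1 + b :=
            exists_add_of_le (Finsupp.single_le_iff.2 (Nat.one_le_iff_ne_zero.2 hi))
          refine Submodule.subset_span ⟨i, monomial b c * h, J.mul_mem_left _ hhJ, ?_, ?_⟩
          · have hb : n = b.degree + d := by
              rw [map_add, Finsupp.degree_single] at hdeg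
              omega
            rw [hb]
            exact (isHomogeneous_monomial c rfl).mul hhd
          · rw [← mul_assoc, X, monomial_mul, one_mul]
        · exact S.zero_mem
      | add p q hp hq =>
        rw [add_mul, map_add]
        exact S.add_mem hp hq
    | zero =>
      intro q
      rw [mul_zero, map_zero]
      exact S.zero_mem
    | add f g _ _ hf hg =>
      intro q
      rw [mul_add, map_add]
      exact S.add_mem (hf q) (hg q)
    | smul p f _ hf =>
      intro q
      rw [smul_eq_mul, ← mul_assoc]
      exact hf (q * p)
  have := key f (hgen ▸ hf) 1
  rwa [one_mul, homogeneousComponent_of_mem ((mem_homogeneousSubmodule _ _).2 hd), if_pos rfl]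
    at this

/-- A family of forms in `J_n` with all possible leading exponents reduces every form in `J_n`. -/
theorem mem_span_image_of_hasLead {F : (Fin r →₀ ℕ) → MvPolynomial (Fin r) ℂ}
    (hFJ : ∀ A ∈ leadSet J n, F A ∈ J) (hFd : ∀ A ∈ leadSet J n, (F A).IsHomogeneous n)
    (hFlead : ∀ A ∈ leadSet J n, HasLead (revLex r) (F A) A)
    {f : MvPolynomial (Fin r) ℂ} (hf : f ∈ J) (hd : f.IsHomogeneous n) {A : Fin r →₀ ℕ}
    (hA : HasLead (revLex r) f A) :
    f ∈ Submodule.span ℂ (F '' {B : Fin r →₀ ℕ | B ∈ leadSet J n ∧ B ≼[revLex r] A}) := by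
  induction hs : (revLex r).toSyn A using WellFoundedLT.induction generalizing A f with
  | ind s ih =>
  subst hs
  have hAJ : A ∈ leadSet J n := ⟨f, hf, hd, hA⟩
  set c := coeff A f / coeff A (F A) with hc
  have hFA : c • F A ∈
      Submodule.span ℂ (F '' {B : Fin r →₀ ℕ | B ∈ leadSet J n ∧ B ≼[revLex r] A}) :=
    Submodule.smul_mem _ _ (Submodule.subset_span ⟨A, ⟨hAJ, le_rfl⟩, rfl⟩)
  have hmem : f - c • F A ∈ J := J.sub_mem hf (Submodule.smul_of_tower_mem _ _ (hFJ A hAJ))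
  have hdeg : (f - c • F A).IsHomogeneous n := by
    rw [smul_eq_C_mul]
    exact hd.sub ((hFd A hAJ).C_mul c)
  rw [← sub_add_cancel f (c • F A)]
  refine Submodule.add_mem _ ?_ hFA
  by_cases h0 : f - c • F A = 0
  · rw [h0]
    exact Submodule.zero_mem _
  have hlead : HasLead (revLex r) (f - c • F A) _ := hasLead_degree h0
  have hlt : (revLex r).degree (f - c • F A) ≺[revLex r] A := by
    by_contra hnot
    refine hlead.1 ?_
    rw [coeff_sub, coeff_smul, smul_eq_mul]
    rcases (not_lt.1 hnot).eq_or_lt with heq | hlt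
    · rw [← (revLex r).toSyn.injective heq, hc, div_mul_cancel₀ _ (hFlead A hAJ).1, sub_self]
    · rw [hA.2 _ hlt, (hFlead A hAJ).2 _ hlt, mul_zero, sub_zero]
  refine Submodule.span_mono (Set.image_mono ?_) (ih _ hlt hmem hdeg hlead rfl)
  exact fun B hB => ⟨hB.1, hB.2.trans hlt.le⟩

/-- By stability, an exponent that is not minimal can be divided by its last variable. -/
theorem exists_single_add_of_not_minimal {d : ℕ}
    (hstable : ∀ i j : Fin r, i < j → ∀ B, Finsupp.single j 1 + B ∈ leadSet J d →
      Finsupp.single i 1 + B ∈ leadSet J d)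
    {i m : Fin r} {B : Fin r →₀ ℕ} (hB : B ∈ leadSet J d)
    (hm : (Finsupp.single i 1 + B : Fin r →₀ ℕ) m ≠ 0) (him : i ≤ m) :
    ∃ B' ∈ leadSet J d, Finsupp.single i 1 + B = Finsupp.single m 1 + B' := by
  rcases him.eq_or_lt with rfl | him
  · exact ⟨B, hB, rfl⟩
  · have hBm : B m ≠ 0 := by simpa [Finsupp.single_apply, him.ne] using hm
    obtain ⟨E, rfl⟩ : ∃ E, B = Finsupp.single m 1 + E :=
      exists_add_of_le (Finsupp.single_le_iff.2 (Nat.one_le_iff_ne_zero.2 hBm))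
    exact ⟨_, hstable i m him E hB, add_left_comm _ _ _⟩

/-- A minimal exponent `P` of degree `n + 1` is smaller than some product `x_i x^A` with `A` minimal
of degree `n` and `i < max(A)`. Otherwise every form in `J_{n+1} = S_1 J_n` would be
a combination of standard products, whose distinct leading exponents are multiples of exponents in
`leadSet J n`, plus a polynomial whose exponents are all smaller than `P`. -/
theorem exists_lt_single_add (hgen : IsGeneratedInDegreeLE J n)
    (hstable : ∀ d, d + 1 = n → ∀ i j : Fin r, i < j → ∀ B,
      Finsupp.single j 1 + B ∈ leadSet J d → Finsupp.single i 1 + B ∈ leadSet J d)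
    {P : Fin r →₀ ℕ} (hP : P ∈ leadSet J (n + 1))
    (hPmin : ∀ i B, P = Finsupp.single i 1 + B → B ∉ leadSet J B.degree) :
    ∃ A ∈ leadSet J n, (∀ i B, A = Finsupp.single i 1 + B → B ∉ leadSet J B.degree) ∧
      ∃ i m, i < m ∧ A m ≠ 0 ∧ P ≺[revLex r] Finsupp.single i 1 + A := by
  classical
  by_contra! hcon
  -- Forms `F A` with leading exponents `A`; if `A` is not minimal, `F A` is a multiple of the last
  -- variable that occurs in `x^A`.
  have hex : ∀ A ∈ leadSet J n, ∃ f ∈ J, f.IsHomogeneous n ∧ HasLead (revLex r) f A ∧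
      ((∃ i B, A = Finsupp.single i 1 + B ∧ B ∈ leadSet J B.degree) →
        ∃ m B f', A = Finsupp.single m 1 + B ∧ (∀ l, A l ≠ 0 → l ≤ m) ∧ f' ∈ J ∧
          f'.IsHomogeneous B.degree ∧ HasLead (revLex r) f' B ∧ f = X m * f') := by
    intro A hA
    by_cases hmin : ∃ i B, A = Finsupp.single i 1 + B ∧ B ∈ leadSet J B.degree
    · obtain ⟨i, B, hAB, hB⟩ := hmin
      have hdeg : B.degree + 1 = n := by
        rw [← degree_of_mem_leadSet hA, hAB, map_add, Finsupp.degree_single, add_comm]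
      have hiA : i ∈ A.support := by simp [hAB]
      set m := A.support.max' ⟨i, hiA⟩ with hm
      have hmA : A m ≠ 0 := Finsupp.mem_support_iff.1 (A.support.max'_mem ⟨i, hiA⟩)
      have hle : ∀ l, A l ≠ 0 → l ≤ m := fun l hl =>
        A.support.le_max' l (Finsupp.mem_support_iff.2 hl)
      obtain ⟨B', hB', hABB'⟩ := exists_single_add_of_not_minimal (hstable _ hdeg) hB
        (m := m) (by rwa [← hAB]) (hle i (Finsupp.mem_support_iff.1 hiA))
      have hB'deg := degree_of_mem_leadSet hB'
      obtain ⟨f', hf', hd', hlead'⟩ := hB'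
      rw [← hAB] at hABB'
      refine ⟨X m * f', J.mul_mem_left _ hf', ?_, ?_, fun _ =>
        ⟨m, B', f', hABB', hle, hf', by rwa [hB'deg], hlead', rfl⟩⟩
      · rw [← hdeg, add_comm]
        exact (isHomogeneous_X ℂ m).mul hd'
      · rw [hABB']
        exact hlead'.X_mul m
    · obtain ⟨f, hf, hd, hlead⟩ := hA
      exact ⟨f, hf, hd, hlead, fun h => absurd h hmin⟩
  choose! F hFJ hFd hFlead hFmin using hex
  -- The standard products `x_k F A` with `k ≥ max(A)`, and the polynomials whose exponents are all
  -- smaller than `P`.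
  let ι := {p : (Fin r →₀ ℕ) × Fin r // p.1 ∈ leadSet J n ∧ ∀ l, p.1 l ≠ 0 → l ≤ p.2}
  have : Fintype ι := Set.Finite.fintype (((finite_leadSet J n).prod Set.finite_univ).subset
    fun p hp => ⟨hp.1, trivial⟩)
  let s : ι → MvPolynomial (Fin r) ℂ := fun p => X p.1.2 * F p.1.1
  let e : ι → Fin r →₀ ℕ := fun p => Finsupp.single p.1.2 1 + p.1.1
  have he : Function.Injective e := by
    have hle : ∀ p q : ι, e p = e q → p.1.2 ≤ q.1.2 := by
      intro p q hpq
      by_contra hlt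
      have hval := DFunLike.congr_fun hpq p.1.2
      have hq : q.1.1 p.1.2 = 0 := by
        by_contra h
        exact hlt (q.2.2 _ h)
      have hne : q.1.2 ≠ p.1.2 := fun h => hlt h.ge
      simp [e, hq, hne] at hval
    intro p q hpq
    have h2 : p.1.2 = q.1.2 := le_antisymm (hle p q hpq) (hle q p hpq.symm)
    have h1 : p.1.1 = q.1.1 := by
      simp only [e, h2] at hpq
      exact add_left_cancel hpq
    exact Subtype.ext (Prod.ext h1 h2)
  let V : Submodule ℂ (MvPolynomial (Fin r) ℂ) :=
    { carrier := {v | ∀ b, P ≼[revLex r] b → coeff b v = 0}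
      zero_mem' := fun _ _ => coeff_zero _
      add_mem' := fun {v w} hv hw b hb => by rw [coeff_add, hv b hb, hw b hb, add_zero]
      smul_mem' := fun c v hv b hb => by rw [coeff_smul, hv b hb, smul_zero] }
  -- Every product `x_i F A` can be rewritten, by induction on its leading exponent.
  have hrewrite : ∀ A ∈ leadSet J n, ∀ i,
      X i * F A ∈ Submodule.span ℂ (Set.range s) ⊔ V := by
    suffices ∀ D : (revLex r).syn, ∀ A ∈ leadSet J n, ∀ i,
        (revLex r).toSyn (Finsupp.single i 1 + A) = D →
        X i * F A ∈ Submodule.span ℂ (Set.range s) ⊔ V from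
      fun A hA i => this _ A hA i rfl
    intro D
    induction D using WellFoundedLT.induction with
    | ind D ih =>
    rintro A hA i rfl
    by_cases hstd : ∀ l, A l ≠ 0 → l ≤ i
    · exact Submodule.mem_sup_left (Submodule.subset_span ⟨⟨(A, i), hA, hstd⟩, rfl⟩)
    push Not at hstd
    obtain ⟨l, hAl, hil⟩ := hstd
    by_cases hmin : ∃ i B, A = Finsupp.single i 1 + B ∧ B ∈ leadSet J B.degree
    · -- With `F A = x_m f'`, reduce `x_i f'` in degree `n` and multiply by `x_m`.
      obtain ⟨m, B, f', hAB, hle, hf', hd', hlead', hFA⟩ := hFmin A hA hmin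
      have hdeg : 1 + B.degree = n := by
        rw [← degree_of_mem_leadSet hA, hAB, map_add, Finsupp.degree_single]
      have hspan := mem_span_image_of_hasLead hFJ hFd hFlead (J.mul_mem_left (X i) hf')
        (hdeg ▸ (isHomogeneous_X ℂ i).mul hd') (hlead'.X_mul i)
      rw [hFA, mul_left_comm]
      generalize X i * f' = h at hspan
      induction hspan using Submodule.span_induction with
      | mem h hh =>
        obtain ⟨E, ⟨hE, hEle⟩, rfl⟩ := hh
        rcases hEle.eq_or_lt with heq | hlt
        · refine Submodule.mem_sup_left (Submodule.subset_span ⟨⟨(E, m), hE, fun k hk => ?_⟩, rfl⟩)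
          rw [(revLex r).toSyn.injective heq] at hk
          by_cases hki : i = k
          · exact hki ▸ hil.le.trans (hle l hAl)
          · refine hle k ?_
            simp only [Finsupp.add_apply, Finsupp.single_apply, hki, if_false, zero_add] at hk
            rw [hAB, Finsupp.add_apply]
            omega
        · refine ih _ ?_ E hE m rfl
          rw [hAB, add_left_comm, map_add, map_add (revLex r).toSyn (Finsupp.single m 1)]
          exact add_lt_add_right hlt _
      | zero => simp
      | add p q _ _ hp hq =>
        rw [mul_add]
        exact Submodule.add_mem _ hp hq
      | smul c p _ hp =>
        rw [mul_smul_comm]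
        exact Submodule.smul_mem _ c hp
    · push Not at hmin
      refine Submodule.mem_sup_right fun b hb => ((hFlead A hA).X_mul i).2 b (lt_of_lt_of_le ?_ hb)
      refine lt_of_le_of_ne (hcon A hA hmin i l hil hAl) fun h => ?_
      refine hPmin i A ((revLex r).toSyn.injective h).symm ?_
      rwa [degree_of_mem_leadSet hA]
  obtain ⟨f, hf, hd, hlead⟩ := hP
  have hmem : f ∈ Submodule.span ℂ (Set.range s) ⊔ V := by
    refine (Submodule.span_le.2 ?_ :
      Submodule.span ℂ _ ≤ _) (mem_span_X_mul_of_isGeneratedInDegreeLE hgen hf hd)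
    rintro _ ⟨i, h, hh, hhd, rfl⟩
    by_cases h0 : h = 0
    · rw [h0, mul_zero]
      exact Submodule.zero_mem _
    have hspan := mem_span_image_of_hasLead hFJ hFd hFlead hh hhd (hasLead_degree h0)
    generalize (revLex r).degree h = D at hspan
    clear h0 hh hhd
    induction hspan using Submodule.span_induction with
    | mem h hh =>
      obtain ⟨E, ⟨hE, -⟩, rfl⟩ := hh
      exact hrewrite E hE i
    | zero => simp
    | add p q _ _ hp hq =>
      rw [mul_add]
      exact Submodule.add_mem _ hp hq
    | smul c p _ hp =>
      rw [mul_smul_comm]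
      exact Submodule.smul_mem _ c hp
  obtain ⟨u, hu, v, hv, huv⟩ := Submodule.mem_sup.1 hmem
  have hulead : HasLead (revLex r) u P := by
    have hcoeff : ∀ b, P ≼[revLex r] b → coeff b u = coeff b f := fun b hb => by
      rw [← huv, coeff_add, hv b hb, add_zero]
    exact ⟨by rw [hcoeff P le_rfl]; exact hlead.1, fun b hb => by
      rw [hcoeff b hb.le]; exact hlead.2 b hb⟩
  obtain ⟨c, hc⟩ := (Submodule.mem_span_range_iff_exists_fun ℂ).1 hu
  have hc0 : c ≠ 0 := by
    rintro rfl
    refine hulead.ne_zero ?_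
    rw [← hc]
    simp
  -- The standard products have distinct leading exponents, so `P` is one of these.
  obtain ⟨p, hp⟩ := exists_hasLead_sum he (fun p : ι => (hFlead p.1.1 p.2.1).X_mul p.1.2) hc0
  rw [hc] at hp
  refine hPmin p.1.2 p.1.1 (hulead.degree_eq.symm.trans hp.degree_eq) ?_
  rw [degree_of_mem_leadSet p.2.1]
  exact p.2.1

end Syzygies

theorem theorem4 (r n : ℕ) (I : Ideal (MvPolynomial (Fin r) ℂ))
    (hI : I.IsHomogeneous (homogeneousSubmodule (Fin r) ℂ))
    (hgen : IsGeneratedInDegreeLE I n) :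
    IsGenericInitialIdeal I (gin I) ∧
      ∀ P : Fin r →₀ ℕ, IsMonomialGenerator (gin I) P → P.degree = n + 1 →
        ∃ J : Fin r →₀ ℕ, IsMonomialGenerator (gin I) J ∧ J.degree = n ∧
          ∃ i : Fin r, (i : WithBot (Fin r)) < maxIndex J ∧
            P ≺[revLex r] (Finsupp.single i 1 + J) := by
  have hgin : IsGenericInitialIdeal I (gin I) :=
    Classical.epsilon_spec (exists_isGenericInitialIdeal hI)
  refine ⟨hgin, fun P hP hPdeg => ?_⟩
  -- A coordinate change `g` with `in(g I) = gin(I)` that is also generic in the degrees `≤ n`.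
  obtain ⟨U, ⟨S, rfl⟩, ⟨g₀, p, hpS, hp⟩, hU⟩ := hgin
  have hp0 : p ≠ 0 := by
    rintro rfl
    simp at hp
  obtain ⟨q, hq, hqgen⟩ := exists_forall_eval_ne_zero_of_finset I (Finset.range (n + 1))
  obtain ⟨g, hg⟩ := exists_eval_entries_ne_zero (mul_ne_zero hp0 hq)
  rw [map_mul] at hg
  have hin := hU g ⟨p, hpS, left_ne_zero_of_mul hg⟩
  have hJ := isHomogeneous_transformIdeal hI g
  rw [← hin, isMonomialGenerator_initialIdeal_iff hJ, hPdeg] at hP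
  obtain ⟨A, hA, hAmin, i, m, him, hm, hlt⟩ := exists_lt_single_add
    (isGeneratedInDegreeLE_transformIdeal hgen g)
    (fun d hd i j hij B => (hqgen g (right_ne_zero_of_mul hg) d
      (Finset.mem_range.2 (by omega))).single_add_mem_leadSet hij) hP.1 hP.2
  have hAdeg := degree_of_mem_leadSet hA
  refine ⟨A, ?_, hAdeg, i, ?_, hlt⟩
  · rw [← hin, isMonomialGenerator_initialIdeal_iff hJ, hAdeg]
    exact ⟨hA, hAmin⟩
  · exact (WithBot.coe_lt_coe.2 him).trans_le
      (Finset.le_max (Finsupp.mem_support_iff.2 hm))
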